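/- All graphs are simple and undirected. Let $G=(V,E)$ be a finite connected graph and $v\in V$; let $E_v$ be the set of edges incident to $v$. **Definitions.** A *square* is a cycle on four vertices; it is *chordless* if it is induced. For a graph $G$, two edges $e,f$ are in relation $\delta(G)$ if (i) $e\ne f$ share a vertex and it is not the case that there is exactly one square containing both $e$ and $f$ and that this square is chordless, or (ii) $e,f$ are opposite edges of a chordless square, or (iii) $e=f$. For a relation $R$ on the edge set, $R^*$ is the finest equivalence relation on the edge set containing $R$. Let $\mathfrak d_v$ be the set of pairs $(e,f)\in\delta(G)$ with $e\in E_v$ or $f\in E_v$. Let $F_v$ be the set of edges that are opposite to $e$ or to $e'$ in some chordless square containing two edges $e,e'\in E_v$ with $(e,e')\notin\mathfrak d_v^*$. The *partial star product* $S_v$ is the subgraph of $G$ with edge set $E_v\cup F_v$ whose vertices are $v$ and all ends of these edges. Let $\mathfrak d_{|S_v}$ be the restriction of $\mathfrak d_v^*$ to the edges of $S_v$. Let $\varphi_1,\dots,\varphi_k$ be the equivalence classes of $\mathfrak d_v^*$ that contain an edge at $v$. The *star factor* $\mathbb S_i$ has vertex set $\{v\}\cup\{w: vw\in\varphi_i\}$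 and its edges are those edges of $G$ between its vertices that are incident to $v$; so it is a star with centre $v$. Let $H=\mathbb S_1\,\Box\cdots\Box\,\mathbb S_k$ be the Cartesian product (the one-vertex graph if $k=0$), let $v_H=(v,\dots,v)$ be the vertex all of whose coordinates are star centres, and let $N_2^H[v_H]$ be the set of vertices at distance at most $2$ from $v_H$ in $H$. A graph with more than one vertex is *prime* if in every representation as a Cartesian product of two graphs one factor has only one vertex. The *product relation* $\sigma(H)$ relates two edges of $H$ if they have the same colour with respect to the prime factorization of $H$, that is, if the ends of both edges differ in the same coordinate (every finite connected graph has a prime factorization, unique up to order and isomorphism of the factors, and all of its representations give the same relation). **Theorem.** 1. There is a graph isomorphism $\gamma$ from $S_v$ onto the subgraph of $H$ induced by $N_2^H[v_H]$, with $\gamma(v)=v_H$ and such that, for every neighbour $w$ of $v$ with $vw\in\varphi_i$, the $i$-th coordinate of $\gamma(w)$ is $w$ and all its other coordinates are $v$. It is an isometric embedding of $S_v$ into $H$, that is, $d_{S_v}(x,y)=d_H(\gamma(x),\gamma(y))$ for all vertices $x,y$ of $S_v$. 2. If $S_v$ is regarded as a subgraph of $H$ by means of this $\gamma$, then $\mathfrak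 d_{|S_v}\subseteq\delta(H)^*\subseteq\sigma(H)$. 3. The relation $\sigma(H)$ has the same number of equivalence classes as $\mathfrak d_{|S_v}$. -/

import Mathlib

namespace PSP

universe u

/-- The closed `k`-neighbourhood `N_k[v]`. -/
def closedNeighborhood {V : Type u} (G : SimpleGraph V) (k : ℕ) (v : V) : Set V :=
  {x | G.edist v x ≤ k}

/-! ### Squares and the relation `δ` -/

/-- `a, b, c, d` are, in this cyclic order, the vertices of a square (a cycle on four
vertices, possibly with chords). -/
def IsSquare {V : Type u} (G : SimpleGraph V) (a b c d : V) : Prop :=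
  G.Adj a b ∧ G.Adj b c ∧ G.Adj c d ∧ G.Adj d a ∧ a ≠ c ∧ b ≠ d

/-- `a, b, c, d` are, in this cyclic order, the vertices of an induced cycle. -/
def IsChordlessSquare {V : Type u} (G : SimpleGraph V) (a b c d : V) : Prop :=
  IsSquare G a b c d ∧ ¬ G.Adj a c ∧ ¬ G.Adj b d

/-- The edges `(v, u)` and `(v, w)` span exactly one square, and that square is chordless.
(A square spanned by these edges is determined by its top vertex `x`.) -/
def SpansUniqueChordlessSquare {V : Type u} (G : SimpleGraph V) (v u w : V) : Prop :=
  ∃ x, IsChordlessSquare G v u x w ∧ ∀ y, IsSquare G v u y w → y = x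

/-- The relation `δ(G)` on the edge set. -/
def delta {V : Type u} (G : SimpleGraph V) (e f : G.edgeSet) : Prop :=
  (∃ v u w, u ≠ w ∧ e.1 = s(v, u) ∧ f.1 = s(v, w) ∧ ¬ SpansUniqueChordlessSquare G v u w) ∨
  (∃ a b c d, IsChordlessSquare G a b c d ∧ e.1 = s(a, b) ∧ f.1 = s(c, d)) ∨
  e = f

/-- `δ(G)*`, the finest equivalence relation on the edge set containing `δ(G)`. -/
def deltaStar {V : Type u} (G : SimpleGraph V) : Setoid G.edgeSet :=
  Relation.EqvGen.setoid (delta G)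

/-- The local relation `𝔡_v`: the pairs of `δ(G)` with at least one edge incident to `v`. -/
def localRel {V : Type u} (G : SimpleGraph V) (v : V) (e f : G.edgeSet) : Prop :=
  (v ∈ e.1 ∨ v ∈ f.1) ∧ delta G e f

/-- `𝔡_v*`, the finest equivalence relation on the edge set containing `𝔡_v`. -/
def localStar {V : Type u} (G : SimpleGraph V) (v : V) : Setoid G.edgeSet :=
  Relation.EqvGen.setoid (localRel G v)

/-! ### The partial star product -/

/-- The set `F_v` of non-primal edges: the edges opposite to an edge at `v` in a chordless
square spanned by two edges at `v` lying in different `𝔡_v*` classes. Since `u` and `w` may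
be exchanged, this covers both edges of the square that are not incident to `v`. -/
def nonPrimalEdges {V : Type u} (G : SimpleGraph V) (v : V) : Set (Sym2 V) :=
  {f | ∃ (u x w : V) (hu : G.Adj v u) (hw : G.Adj v w), IsChordlessSquare G v u x w ∧
    ¬ localStar G v ⟨s(v, u), hu⟩ ⟨s(v, w), hw⟩ ∧ f = s(u, x)}

/-- The edge set `E_v ∪ F_v` of the partial star product. -/
def pspEdges {V : Type u} (G : SimpleGraph V) (v : V) : Set (Sym2 V) :=
  G.incidenceSet v ∪ nonPrimalEdges G v

theorem pspEdges_subset {V : Type u} (G : SimpleGraph V) (v : V) :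
    pspEdges G v ⊆ G.edgeSet := by
  rintro e (he | ⟨u, x, w, hu, hw, hs, -, rfl⟩)
  · exact he.1
  · exact hs.1.2.1

/-- The partial star product `S_v`: the subgraph with edge set `E_v ∪ F_v` whose vertices are
the centre `v` and the ends of these edges. (The centre is such an end unless it is isolated.) -/
def partialStarProduct {V : Type u} (G : SimpleGraph V) (v : V) : G.Subgraph where
  verts := {x | x = v ∨ ∃ e ∈ pspEdges G v, x ∈ e}
  Adj x y := s(x, y) ∈ pspEdges G v
  adj_sub h := pspEdges_subset G v h
  edge_vert h := Or.inr ⟨_, h, Sym2.mem_mk_left _ _⟩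
  symm := ⟨fun _ _ h => by rwa [Sym2.eq_swap]⟩

/-- The centre, as a vertex of the partial star product. -/
def pspCenter {V : Type u} (G : SimpleGraph V) (v : V) : (partialStarProduct G v).verts :=
  ⟨v, Or.inl rfl⟩

/-- A neighbour of the centre, as a vertex of the partial star product. -/
def pspPrimal {V : Type u} (G : SimpleGraph V) (v w : V) (h : G.Adj v w) :
    (partialStarProduct G v).verts :=
  ⟨w, Or.inr ⟨s(v, w), Or.inl ⟨h, Sym2.mem_mk_left _ _⟩, Sym2.mem_mk_right _ _⟩⟩

/-- The restriction `𝔡_{|S_v}` of `𝔡_v*` to the edges of `S_v`. -/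
def restrictedRel {V : Type u} (G : SimpleGraph V) (v : V) :
    Setoid (partialStarProduct G v).coe.edgeSet :=
  (localStar G v).comap (partialStarProduct G v).hom.mapEdgeSet

/-! ### Star factors and their Cartesian product -/

/-- The classes of `𝔡_v*`. Since `𝔡_v` only concerns pairs with an edge at `v`, only the
classes containing an edge at `v` are meant (every other class is a single edge that `𝔡_v`
relates to nothing; it would contribute a one-vertex factor). -/
def LocalClass {V : Type u} (G : SimpleGraph V) (v : V) : Type u :=
  {φ : Quotient (localStar G v) // ∃ e : G.edgeSet, v ∈ e.1 ∧ Quotient.mk _ e = φ}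

/-- The class of the edge `(v, w)`. -/
def classOf {V : Type u} (G : SimpleGraph V) (v w : V) (h : G.Adj v w) : LocalClass G v :=
  ⟨Quotient.mk _ ⟨s(v, w), h⟩, ⟨s(v, w), h⟩, Sym2.mem_mk_left _ _, rfl⟩

/-- The closed `φ`-neighbourhood `N_φ[v]`. -/
def classNeighborhood {V : Type u} (G : SimpleGraph V) (v : V) (φ : LocalClass G v) : Set V :=
  {x | x = v ∨ ∃ h : G.Adj v x, classOf G v x h = φ}

/-- The star factor of the class `φ`: its vertex set is `N_φ[v]`, its edges are the edges of
the subgraph of `G` induced on `N_φ[v]` that are incident to `v`. -/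
def starFactor {V : Type u} (G : SimpleGraph V) (v : V) (φ : LocalClass G v) :
    SimpleGraph (classNeighborhood G v φ) where
  Adj x y := G.Adj x.1 y.1 ∧ (x.1 = v ∨ y.1 = v)
  symm := ⟨fun _ _ h => ⟨h.1.symm, h.2.symm⟩⟩
  loopless := ⟨fun _ h => h.1.ne rfl⟩

/-- The Cartesian product of a family of graphs. -/
def cartesianProduct {ι : Type u} {X : ι → Type u} (F : ∀ i, SimpleGraph (X i)) :
    SimpleGraph (∀ i, X i) where
  Adj x y := ∃ i, (F i).Adj (x i) (y i) ∧ ∀ j, j ≠ i → x j = y j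
  symm := ⟨fun _ _ h => by
    obtain ⟨i, hi, hj⟩ := h
    exact ⟨i, hi.symm, fun j hji => (hj j hji).symm⟩⟩
  loopless := ⟨fun _ h => by
    obtain ⟨i, hi, -⟩ := h
    exact hi.ne rfl⟩

/-- The Cartesian product `H` of the star factors of `S_v`. -/
def starProduct {V : Type u} (G : SimpleGraph V) (v : V) :
    SimpleGraph (∀ φ : LocalClass G v, classNeighborhood G v φ) :=
  cartesianProduct (starFactor G v)

/-- The vertex of `H` all of whose coordinates are star centres. -/
def starCenter {V : Type u} (G : SimpleGraph V) (v : V) :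
    ∀ φ : LocalClass G v, classNeighborhood G v φ :=
  fun _ => ⟨v, Or.inl rfl⟩

/-! ### Prime factorizations and the product relation `σ` -/

/-- A graph is prime with respect to the Cartesian product if it has more than one vertex and
in every representation as a Cartesian product of two graphs one factor has only one vertex.
(Both factors embed into the graph, so that the universe of the factors is no restriction.) -/
def IsPrime {V : Type u} (G : SimpleGraph V) : Prop :=
  Nontrivial V ∧ ∀ (A B : Type u) (K : SimpleGraph A) (L : SimpleGraph B),
    Nonempty (G ≃g K.boxProd L) → Subsingleton A ∨ Subsingleton B

/-- A representation of a graph as a Cartesian product of finitely many prime graphs. -/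
structure PrimeFactorization {V : Type u} (G : SimpleGraph V) where
  ι : Type u
  finite_index : Finite ι
  X : ι → Type u
  factor : ∀ i, SimpleGraph (X i)
  prime : ∀ i, IsPrime (factor i)
  iso : G ≃g cartesianProduct factor

/-- The set of coordinates in which the ends of an edge differ. By the definition of the
Cartesian product it has exactly one element, the Cartesian colour of the edge. -/
def PrimeFactorization.colour {V : Type u} {G : SimpleGraph V} (P : PrimeFactorization G)
    (e : G.edgeSet) : Set P.ι :=
  {i | ∃ x ∈ e.1, ∃ y ∈ e.1, P.iso x i ≠ P.iso y i}

/-- The product relation `σ(G)`: two edges are related if they have the same Cartesian colour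
with respect to the prime factorization. The prime factorization of a finite connected graph
is unique up to order and isomorphisms of the factors, so that all representations define the
same relation; we ask for the same colour in every one of them. -/
def sigma {V : Type u} (G : SimpleGraph V) : Setoid G.edgeSet where
  r e f := ∀ P : PrimeFactorization G, P.colour e = P.colour f
  iseqv := ⟨fun _ _ => rfl, fun h P => (h P).symm, fun h k P => (h P).trans (k P)⟩

/-- A map of the partial star product onto an induced subgraph of a graph `H`, as a
homomorphism into `H`. -/
def intoHom {V W : Type u} {S : SimpleGraph V} {H : SimpleGraph W} {N : Set W}
    (γ : S ≃g H.induce N) : S →g H :=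
  (SimpleGraph.Embedding.induce N).toHom.comp γ.toHom

end PSP

/-! Two edges at `v` in different local classes are not in `δ`, so they span exactly one square, and
it is chordless (`spans_of_classOf_ne`). The vertices of the partial star product are therefore `v`,
its neighbours, and the tops `x` of such squares. The crucial rigidity is that a top `x` over `u`
and `w` has no further common neighbour with `v` (`IsTop.eq_or_eq`): a third one would put `wv` and
`wx` into two squares, and since `wx` is opposite to `vu`, the classes of `vu` and `vw` would merge.

Hence each vertex is determined by the set of neighbours of `v` below it: none for `v`, one for a
neighbour, two from different classes for a top. Reading this set as a choice of leaves in the star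
factors gives coordinates in `H` (`starCoord`), and these fill exactly the vertices of `H` with at
most two non-central coordinates, which form the ball of radius two. Opposite edges of a spanned
square are locally equivalent, so the colour of an edge in `H` is its local class.

The rest concerns products of stars. Distance is the sum of the coordinate distances, and geodesics
can be chosen to move coordinates towards the centre first, so balls around the centre are
isometric. Edges of one colour are `δ*`-equivalent: squares carry them to the layer through the
centre, and two edges of one star span no square. In any product, `δ` preserves colours. Since stars
are prime, the star factors form a prime factorization and both relations have one class per star.
-/

namespace PSP

universe u

/-! ### Colours of edges in Cartesian products -/

section Product

variable {ι : Type u} {X : ι → Type u} {F : ∀ i, SimpleGraph (X i)}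

/-- In a square of a Cartesian product, opposite edges differ in the same coordinates. -/
theorem IsSquare.colour_eq {a b c d : ∀ i, X i} (h : IsSquare (cartesianProduct F) a b c d)
    (i : ι) : a i ≠ b i ↔ c i ≠ d i := by
  obtain ⟨⟨p, hp, hp'⟩, ⟨q, hq, hq'⟩, ⟨r, hr, hr'⟩, ⟨s, hs, hs'⟩, hac, hbd⟩ := h
  have hp := hp.ne
  have hq := hq.ne
  have hr := hr.ne
  have hs := hs.ne
  obtain ⟨k, hk⟩ := Function.ne_iff.1 hac
  obtain ⟨l, hl⟩ := Function.ne_iff.1 hbd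
  -- Around a closed walk every changed coordinate changes at least twice. If opposite edges did not
  -- share their coordinate, consecutive ones would, and then `a = c` or `b = d`.
  have key : r = p := by grind +splitImp
  grind

/-- Two incident edges of different colours span a unique square, which is chordless. -/
theorem spans_of_colour_ne {a b c : ∀ i, X i} (hab : (cartesianProduct F).Adj a b)
    (hac : (cartesianProduct F).Adj a c) {i : ι} (hi : a i ≠ b i) (hi' : a i = c i) :
    SpansUniqueChordlessSquare (cartesianProduct F) a b c := by
  classical
  obtain ⟨p, hp, hp'⟩ := hab
  obtain ⟨q, hq, hq'⟩ := hac
  obtain rfl : i = p := by grind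
  have hiq : i ≠ q := by rintro rfl; exact hq.ne hi'
  have hpn := hp.ne
  have hqn := hq.ne
  -- The fourth vertex combines both moves: coordinate `i` from `b`, coordinate `q` from `c`.
  refine ⟨Function.update b q (c q), ⟨⟨⟨i, hp, hp'⟩, ⟨q, ?_, ?_⟩, ⟨i, ?_, ?_⟩, ⟨q, hq.symm, ?_⟩, ?_, ?_⟩, ?_, ?_⟩, ?_⟩
  · simpa [← hp' q hiq.symm] using hq
  · grind
  · simpa [hiq, ← hi'] using hp.symm
  · grind
  · grind
  · intro h
    have := congrFun h q
    simp at this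
    grind
  · grind
  · rintro ⟨k, -, hk⟩
    have := hk i
    have := hk q
    grind
  · rintro ⟨k, -, hk⟩
    have := hk i
    have := hk q
    grind
  -- Since `b` and `c` differ exactly at `i` and `q`, a common neighbour takes one of these
  -- coordinates from each of them. One of the two choices is `a`, which `hay` excludes.
  · rintro y ⟨-, ⟨k, hk, hk'⟩, ⟨l, hl, hl'⟩, -, hay, hbc⟩
    have hk := hk.ne
    have hl := hl.ne
    obtain ⟨m, hm⟩ := Function.ne_iff.1 hay
    funext n
    have := hk' i
    have := hk' q
    have := hl' i
    have := hl' q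
    have := hk' m
    have := hl' m
    have := hp' m
    have := hq' m
    by_cases hn : n = q
    · subst hn; rw [Function.update_self]; grind +splitImp
    · rw [Function.update_of_ne hn]
      grind +splitImp

end Product

theorem isSquare_iso_iff {V W : Type u} {G : SimpleGraph V} {H : SimpleGraph W} (f : G ≃g H)
    (a b c d : V) : IsSquare H (f a) (f b) (f c) (f d) ↔ IsSquare G a b c d := by
  simp [IsSquare, SimpleGraph.Iso.map_adj_iff]

theorem spans_iso {V W : Type u} {G : SimpleGraph V} {H : SimpleGraph W} (f : G ≃g H)
    {a b c : V} (h : SpansUniqueChordlessSquare H (f a) (f b) (f c)) :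
    SpansUniqueChordlessSquare G a b c := by
  obtain ⟨x, hx, hu⟩ := h
  obtain ⟨x, rfl⟩ := f.surjective x
  refine ⟨x, by simpa [IsChordlessSquare, isSquare_iso_iff, SimpleGraph.Iso.map_adj_iff] using hx, fun y hy => ?_⟩
  exact f.injective (hu _ ((isSquare_iso_iff f _ _ _ _).2 hy))

/-! ### The product relation contains `δ*` -/

namespace PrimeFactorization

variable {V : Type u} {G : SimpleGraph V}

theorem mem_colour (P : PrimeFactorization G) {e : G.edgeSet} {x y : V} (h : e.1 = s(x, y))
    (i : P.ι) : i ∈ P.colour e ↔ P.iso x i ≠ P.iso y i := by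
  simp only [colour, Set.mem_ofPred_eq, h, Sym2.mem_iff]
  grind

/-- Incident edges of different colours would span a unique chordless square, against case (i) of
`δ`; opposite edges of a square agree in colour by the coordinate count. -/
theorem colour_eq_of_delta (P : PrimeFactorization G) {e f : G.edgeSet} (h : delta G e f) :
    P.colour e = P.colour f := by
  obtain ⟨v, a, b, hab, he, hf, hs⟩ | ⟨a, b, c, d, hs, he, hf⟩ | rfl := h
  · have hva : G.Adj v a := by simpa [he] using e.2
    have hvb : G.Adj v b := by simpa [hf] using f.2
    have hva' : (cartesianProduct P.factor).Adj (P.iso v) (P.iso a) := P.iso.map_adj_iff.2 hva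
    have hvb' : (cartesianProduct P.factor).Adj (P.iso v) (P.iso b) := P.iso.map_adj_iff.2 hvb
    have h1 : ∀ i, P.iso v i ≠ P.iso a i → P.iso v i ≠ P.iso b i := fun i hi hi' =>
      hs (spans_iso P.iso (spans_of_colour_ne hva' hvb' hi hi'))
    obtain ⟨p, hp, hp'⟩ := hva'
    obtain ⟨q, hq, hq'⟩ := hvb'
    have hp := hp.ne
    ext i
    rw [P.mem_colour he, P.mem_colour hf]
    refine ⟨h1 i, fun hi => ?_⟩
    have h2 : p = q := by grind
    grind
  · ext i
    rw [P.mem_colour he, P.mem_colour hf]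
    exact IsSquare.colour_eq ((isSquare_iso_iff P.iso _ _ _ _).2 hs.1) i
  · rfl

end PrimeFactorization

/-- `δ(G)*` is contained in the product relation. -/
theorem sigma_of_deltaStar {V : Type u} {G : SimpleGraph V} {e f : G.edgeSet}
    (h : deltaStar G e f) : sigma G e f := by
  have : deltaStar G ≤ sigma G := Setoid.eqvGen_le fun _ _ h P => P.colour_eq_of_delta h
  exact this h

/-! ### Cartesian products of stars -/

/-- A star is prime. -/
theorem isPrime_starGraph {X : Type u} [hX : Nontrivial X] (c : X) :
    IsPrime (SimpleGraph.starGraph c) := by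
  refine ⟨hX, fun A B K L ⟨f⟩ => ?_⟩
  by_contra! h
  obtain ⟨hA, hB⟩ := h
  obtain ⟨a, ha⟩ := exists_ne (f c).1
  obtain ⟨b, hb⟩ := exists_ne (f c).2
  -- The centre of a star is adjacent to every other vertex, but in a box product no vertex is
  -- adjacent to one differing from it in both coordinates.
  have hne : f.symm (a, b) ≠ c := by
    intro h
    have := f.apply_symm_apply (a, b)
    rw [h] at this
    exact ha (by rw [this])
  have hadj : (SimpleGraph.starGraph c).Adj c (f.symm (a, b)) := by
    simpa using hne.symm
  have := f.map_adj_iff.2 hadj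
  simp only [RelIso.apply_symm_apply, SimpleGraph.boxProd_adj] at this
  grind

section StarProduct

variable {ι : Type u} {X : ι → Type u} (c : ∀ i, X i)

/-- The Cartesian product of the stars with centres `c i`. -/
def starBox : SimpleGraph (∀ i, X i) :=
  cartesianProduct fun i => SimpleGraph.starGraph (c i)

theorem starBox_adj {x y : ∀ i, X i} : (starBox c).Adj x y ↔
    ∃ i, (x i ≠ y i ∧ (x i = c i ∨ y i = c i)) ∧ ∀ j, j ≠ i → x j = y j := by
  simp [starBox, cartesianProduct]

theorem starBox_adj_update [DecidableEq ι] (z : ∀ i, X i) {i : ι} {x : X i} (hx : x ≠ c i) :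
    (starBox c).Adj (Function.update z i (c i)) (Function.update z i x) := by
  refine (starBox_adj c).2 ⟨i, by simpa using hx.symm, fun j hj => by simp [hj]⟩

/-- The edge of colour `i` from `z` with its `i`-th coordinate replaced by the centre to `z` with
its `i`-th coordinate replaced by `x`. -/
def fibreEdge [DecidableEq ι] (z : ∀ i, X i) {i : ι} {x : X i} (hx : x ≠ c i) :
    (starBox c).edgeSet :=
  ⟨s(Function.update z i (c i), Function.update z i x), starBox_adj_update c z hx⟩

/-- In a star every edge contains the centre, so one end of an edge of the product has a central
entry in the coordinate that changes. -/
theorem exists_eq_fibreEdge [DecidableEq ι] (e : (starBox c).edgeSet) :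
    ∃ (z : ∀ i, X i) (i : ι) (x : X i) (hx : x ≠ c i), e = fibreEdge c z hx := by
  obtain ⟨e, he⟩ := e
  induction e with | _ a b
  have he' : (starBox c).Adj a b := he
  obtain ⟨i, ⟨hab, h⟩, hj⟩ := (starBox_adj c).1 he'
  rcases h with h | h
  · refine ⟨a, i, b i, by grind, Subtype.ext ?_⟩
    have h1 : Function.update a i (c i) = a := by rw [← h, Function.update_eq_self]
    have h2 : Function.update a i (b i) = b := by
      funext j
      by_cases hji : j = i
      · subst hji; simp
      · simp [hji, hj j hji]
    simp [fibreEdge, h1, h2]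
  · refine ⟨b, i, a i, by grind, Subtype.ext ?_⟩
    have h1 : Function.update b i (c i) = b := by rw [← h, Function.update_eq_self]
    have h2 : Function.update b i (a i) = a := by
      funext j
      by_cases hji : j = i
      · subst hji; simp
      · simp [hji, hj j hji]
    simp [fibreEdge, h1, h2, Sym2.eq_swap]

/-- Two edges of the same star layer are in relation `δ`. -/
theorem delta_fibreEdge_same [DecidableEq ι] (z : ∀ i, X i) {i : ι} {x x' : X i}
    (hx : x ≠ c i) (hx' : x' ≠ c i) :
    delta (starBox c) (fibreEdge c z hx) (fibreEdge c z hx') := by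
  by_cases hxx : x = x'
  · subst hxx; exact Or.inr (Or.inr rfl)
  refine Or.inl ⟨_, _, _, ?_, rfl, rfl, ?_⟩
  · intro h
    simpa [hxx] using congrFun h i
  -- A common neighbour of two leaves of one layer can differ from them only in coordinate `i`,
  -- hence is the centre of that layer, which a square forbids.
  · rintro ⟨y, ⟨⟨-, h1, h2, -, hy, -⟩, -⟩, -⟩
    obtain ⟨k, ⟨hk, hkc⟩, hk'⟩ := (starBox_adj c).1 h1
    obtain ⟨l, ⟨hl, hlc⟩, hl'⟩ := (starBox_adj c).1 h2
    apply hy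
    funext j
    have a1 := hk' i
    have a2 := hl' i
    by_cases hji : j = i
    · subst hji
      simp only [Function.update_self] at *
      grind
    · have a3 := hk' j
      have a4 := hl' j
      have a5 := hl' k
      have a6 := hk' l
      simp only [Function.update_self, Function.update_of_ne hji] at *
      grind

/-- Moving an edge of colour `i` along another coordinate `k` sweeps out a chordless square in which
the old and the new edge are opposite. -/
theorem deltaStar_fibreEdge_update [DecidableEq ι] (z : ∀ i, X i) {i : ι} {x : X i}
    (hx : x ≠ c i) (k : ι) :
    deltaStar (starBox c) (fibreEdge c z hx) (fibreEdge c (Function.update z k (c k)) hx) := by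
  by_cases hki : k = i
  · subst hki
    simp only [fibreEdge, Function.update_idem]
    exact (deltaStar _).refl' _
  by_cases hkz : z k = c k
  · rw [← hkz, Function.update_eq_self]
  refine Relation.EqvGen.rel _ _ (Or.inr (Or.inl ⟨Function.update z i (c i), Function.update z i x,
    Function.update (Function.update z k (c k)) i x,
    Function.update (Function.update z k (c k)) i (c i), ?_, rfl, Sym2.eq_swap⟩))
  have hne {y y' : X i} (hy : y ≠ y') :
      Function.update z i y ≠ Function.update (Function.update z k (c k)) i y' := fun h => by
    simpa [hy] using congrFun h i
  have hnadj {y y' : X i} (hy : y ≠ y') : ¬ (starBox c).Adj (Function.update z i y)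
      (Function.update (Function.update z k (c k)) i y') := fun h => by
    obtain ⟨l, -, hl⟩ := (starBox_adj c).1 h
    have h1 := hl i
    have h2 := hl k
    simp only [Function.update_self, Function.update_of_ne hki] at h1 h2
    grind
  have hadj (y : X i) : (starBox c).Adj (Function.update z i y)
      (Function.update (Function.update z k (c k)) i y) :=
    (starBox_adj c).2 ⟨k, by simp [hki, hkz], fun j hj => by
      by_cases hji : j = i
      · subst hji; simp
      · simp [hji, hj]⟩
  exact ⟨⟨starBox_adj_update c z hx, hadj x, (starBox_adj_update c _ hx).symm, (hadj (c i)).symm,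
    hne hx.symm, hne hx⟩, hnadj hx.symm, hnadj hx⟩

theorem deltaStar_fibreEdge_center [DecidableEq ι] [Finite ι] (z : ∀ i, X i) {i : ι} {x : X i}
    (hx : x ≠ c i) : deltaStar (starBox c) (fibreEdge c z hx) (fibreEdge c c hx) := by
  have := Fintype.ofFinite ι
  have key : ∀ s : Finset ι, deltaStar (starBox c) (fibreEdge c z hx)
      (fibreEdge c (fun k => if k ∈ s then c k else z k) hx) := by
    intro s
    induction s using Finset.induction_on with
    | empty => simp only [Finset.notMem_empty, if_false]; exact (deltaStar _).refl' _
    | insert a s ha ih =>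
      refine (deltaStar _).trans' ih ?_
      convert deltaStar_fibreEdge_update c (fun k => if k ∈ s then c k else z k) hx a using 2
      funext k
      by_cases hk : k = a
      · subst hk; simp
      · simp [hk]
  simpa using key Finset.univ

/-- Edges of the same colour in a product of stars are in relation `δ*`. -/
theorem deltaStar_fibreEdge [DecidableEq ι] [Finite ι] (z z' : ∀ i, X i) {i : ι} {x x' : X i}
    (hx : x ≠ c i) (hx' : x' ≠ c i) :
    deltaStar (starBox c) (fibreEdge c z hx) (fibreEdge c z' hx') :=
  (deltaStar _).trans' (deltaStar_fibreEdge_center c z hx) <|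
    (deltaStar _).trans' (Relation.EqvGen.rel _ _ (delta_fibreEdge_same c c hx hx')) <|
      (deltaStar _).symm' (deltaStar_fibreEdge_center c z' hx')

/-- The prime factorization of a product of nontrivial stars. -/
def starBoxFactorization [Finite ι] [∀ i, Nontrivial (X i)] :
    PrimeFactorization (starBox c) where
  ι := ι
  finite_index := inferInstance
  X := X
  factor i := SimpleGraph.starGraph (c i)
  prime i := isPrime_starGraph (c i)
  iso := SimpleGraph.Iso.refl

/-- The product relation of a product of `k` nontrivial stars has `k` classes. -/
theorem card_quotient_sigma_starBox [Finite ι] [∀ i, Nontrivial (X i)] :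
    Nat.card (Quotient (sigma (starBox c))) = Nat.card ι := by
  classical
  choose x hx using fun i => exists_ne (c i)
  refine (Nat.card_congr (Equiv.ofBijective
    (fun i => (Quotient.mk _ (fibreEdge c c (hx i)) : Quotient (sigma (starBox c)))) ⟨?_, ?_⟩)).symm
  · intro i j hij
    -- `sigma` demands equal colours in every prime factorization; the one into stars already
    -- separates different coordinates.
    have h := (Quotient.exact hij) (starBoxFactorization c)
    have hi : i ∈ (starBoxFactorization c).colour (fibreEdge c c (hx i)) := by
      refine ((starBoxFactorization c).mem_colour rfl i).2 ?_
      change Function.update c i (c i) i ≠ Function.update c i (x i) i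
      simpa using (hx i).symm
    rw [h] at hi
    replace hi : Function.update c j (c j) i ≠ Function.update c j (x j) i :=
      ((starBoxFactorization c).mem_colour rfl i).1 hi
    by_contra hne
    simp [hne] at hi
  · intro q
    induction q using Quotient.inductionOn with | _ e
    obtain ⟨z, i, y, hy, rfl⟩ := exists_eq_fibreEdge c e
    exact ⟨i, Quotient.sound (sigma_of_deltaStar (deltaStar_fibreEdge c c z (hx i) hy))⟩

end StarProduct

/-! ### Distances in products of stars -/

theorem edist_map_le {V W : Type*} {G : SimpleGraph V} {H : SimpleGraph W} (f : G →g H)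
    (x y : V) : H.edist (f x) (f y) ≤ G.edist x y := by
  refine le_iInf fun p => ?_
  simpa using SimpleGraph.edist_le (p.map f)

theorem edist_iso {V W : Type*} {G : SimpleGraph V} {H : SimpleGraph W} (f : G ≃g H)
    (x y : V) : G.edist x y = H.edist (f x) (f y) := by
  refine le_antisymm ?_ (edist_map_le f.toHom x y)
  simpa using edist_map_le f.symm.toHom (f x) (f y)

section StarDistance

variable {ι : Type u} {X : ι → Type u} (c : ∀ i, X i)

open Classical in
/-- The distance of two vertices of a star. -/
noncomputable def starDist {Y : Type u} (r x y : Y) : ℕ :=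
  if x = y then 0 else (if x = r then 0 else 1) + (if y = r then 0 else 1)

/-- The sum of the coordinate distances in a product of stars. -/
noncomputable def starBoxDist [Fintype ι] (a b : ∀ i, X i) : ℕ :=
  ∑ i, starDist (c i) (a i) (b i)

/-- Only one summand changes along an edge, and by at most one; summed over a walk this bounds the
distance from below. -/
theorem starBoxDist_le_of_adj [Fintype ι] {a b : ∀ i, X i} (h : (starBox c).Adj a b)
    (d : ∀ i, X i) : starBoxDist c a d ≤ starBoxDist c b d + 1 := by
  classical
  obtain ⟨i, ⟨hi, hc⟩, hj⟩ := (starBox_adj c).1 h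
  calc starBoxDist c a d ≤ ∑ j, (starDist (c j) (b j) (d j) + if j = i then 1 else 0) := by
        refine Finset.sum_le_sum fun j _ => ?_
        by_cases hji : j = i
        · subst hji
          simp only [starDist, if_true]
          grind
        · simp [hji, hj j hji]
    _ = _ := by simp [Finset.sum_add_distrib, starBoxDist]

theorem starBoxDist_self [Fintype ι] (a : ∀ i, X i) : starBoxDist c a a = 0 := by
  simp [starBoxDist, starDist]

theorem starBoxDist_comm [Fintype ι] (a b : ∀ i, X i) :
    starBoxDist c a b = starBoxDist c b a := by
  refine Finset.sum_congr rfl fun i _ => ?_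
  simp only [starDist]
  grind

theorem starBoxDist_le_length [Fintype ι] {a b : ∀ i, X i} (p : (starBox c).Walk a b) :
    starBoxDist c a b ≤ p.length := by
  induction p with
  | nil => simp [starBoxDist_self]
  | cons h p ih =>
    have := starBoxDist_le_of_adj c h
    rw [SimpleGraph.Walk.length_cons]
    exact (this _).trans (by omega)

theorem starBoxDist_update_add_one [Fintype ι] [DecidableEq ι] {a b : ∀ i, X i} {i : ι}
    (hi : a i ≠ b i) (hc : a i ≠ c i) :
    starBoxDist c (Function.update a i (c i)) b + 1 = starBoxDist c a b := by
  rw [starBoxDist, starBoxDist, ← Finset.add_sum_erase _ _ (Finset.mem_univ i),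
    ← Finset.add_sum_erase (a := i) _ (fun i => starDist (c i) (a i) (b i)) (Finset.mem_univ i)]
  have h1 : ∑ j ∈ Finset.univ.erase i, starDist (c j) (Function.update a i (c i) j) (b j) =
      ∑ j ∈ Finset.univ.erase i, starDist (c j) (a j) (b j) := by
    refine Finset.sum_congr rfl fun j hj => ?_
    rw [Function.update_of_ne (Finset.ne_of_mem_erase hj)]
  rw [h1, Function.update_self]
  have h2 : starDist (c i) (c i) (b i) + 1 = starDist (c i) (a i) (b i) := by
    simp only [starDist]
    grind
  omega

theorem adj_update_center [DecidableEq ι] {a : ∀ i, X i} {i : ι} (hc : a i ≠ c i) :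
    (starBox c).Adj a (Function.update a i (c i)) := by
  simpa using (starBox_adj_update c a hc).symm

/-- A set that is closed under replacing coordinates by centres induces an isometric subgraph. -/
theorem edist_induce_le [Fintype ι] [DecidableEq ι] {N : Set (∀ i, X i)}
    (hN : ∀ a ∈ N, ∀ i, Function.update a i (c i) ∈ N) (n : ℕ) (a b : N)
    (hn : starBoxDist c a.1 b.1 = n) : ((starBox c).induce N).edist a b ≤ n := by
  induction n generalizing a b with
  | zero =>
    have hab : a = b := by
      refine Subtype.ext (funext fun i => ?_)
      have h := (Finset.sum_eq_zero_iff.1 hn) i (Finset.mem_univ i)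
      simp only [starDist] at h
      grind
    simp [hab]
  | succ n ih =>
    have step (a b : N) (hn : starBoxDist c a.1 b.1 = n + 1) (i : ι) (hi : a.1 i ≠ b.1 i)
        (hc : a.1 i ≠ c i) : ((starBox c).induce N).edist a b ≤ (n + 1 : ℕ) := by
      have h1 := ih ⟨_, hN a.1 a.2 i⟩ b (by
        have := starBoxDist_update_add_one c hi hc
        dsimp only
        omega)
      have h2 : ((starBox c).induce N).edist a ⟨_, hN a.1 a.2 i⟩ = 1 :=
        SimpleGraph.edist_eq_one_iff_adj.2 (adj_update_center c hc)
      refine (SimpleGraph.edist_triangle (v := ⟨_, hN a.1 a.2 i⟩)).trans ?_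
      rw [h2, Nat.cast_succ, add_comm]
      gcongr
    have hab : a.1 ≠ b.1 := fun h => by simp [h, starBoxDist_self] at hn
    obtain ⟨i, hi⟩ := Function.ne_iff.1 hab
    by_cases hc : a.1 i = c i
    -- If `a` is already central at `i`, then `b` is not, and the step towards the centre is taken
    -- from `b`.
    · rw [SimpleGraph.edist_comm]
      exact step b a (by rwa [starBoxDist_comm]) i hi.symm (fun h => hi (hc.trans h.symm))
    · exact step a b hn i hi hc

theorem edist_starBox [Fintype ι] (a b : ∀ i, X i) :
    (starBox c).edist a b = starBoxDist c a b := by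
  classical
  refine le_antisymm ?_ (le_iInf fun p => by exact_mod_cast starBoxDist_le_length c p)
  exact (edist_map_le (SimpleGraph.Embedding.induce Set.univ).toHom ⟨a, trivial⟩ ⟨b, trivial⟩).trans
    (edist_induce_le c (N := Set.univ) (fun _ _ _ => trivial) _ ⟨a, trivial⟩ ⟨b, trivial⟩ rfl)

theorem mem_closedNeighborhood_starBox [Fintype ι] {k : ℕ} {a : ∀ i, X i} :
    a ∈ closedNeighborhood (starBox c) k c ↔ starBoxDist c c a ≤ k := by
  change (starBox c).edist c a ≤ k ↔ _
  rw [edist_starBox]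
  exact Nat.cast_le

theorem edist_induce_closedNeighborhood [Finite ι] (k : ℕ)
    (a b : closedNeighborhood (starBox c) k c) :
    ((starBox c).induce (closedNeighborhood (starBox c) k c)).edist a b =
      (starBox c).edist a.1 b.1 := by
  classical
  have := Fintype.ofFinite ι
  refine le_antisymm ?_ (edist_map_le (SimpleGraph.Embedding.induce _).toHom a b)
  rw [edist_starBox]
  -- Balls around the centre are closed under centring a coordinate, which only lowers the distance
  -- to the centre.
  refine edist_induce_le c (fun a ha i => ?_) _ a b rfl
  rw [mem_closedNeighborhood_starBox] at ha ⊢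
  rw [starBoxDist_comm] at ha ⊢
  by_cases hi : a i = c i
  · rwa [← hi, Function.update_eq_self]
  · have := starBoxDist_update_add_one c hi hi
    omega

theorem starBoxDist_center [Fintype ι] (a : ∀ i, X i) [DecidablePred fun i => a i ≠ c i] :
    starBoxDist c c a = (Finset.univ.filter fun i => a i ≠ c i).card := by
  rw [Finset.card_filter]
  refine Finset.sum_congr rfl fun i _ => ?_
  simp only [starDist]
  grind

/-- The vertices at distance at most two from the centre of a product of stars. -/
theorem mem_closedNeighborhood_two_iff [Finite ι] [DecidableEq ι] {a : ∀ i, X i} :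
    a ∈ closedNeighborhood (starBox c) 2 c ↔ a = c ∨
      (∃ i x, x ≠ c i ∧ a = Function.update c i x) ∨
      ∃ i j x y, i ≠ j ∧ x ≠ c i ∧ y ≠ c j ∧
        a = Function.update (Function.update c i x) j y := by
  classical
  have := Fintype.ofFinite ι
  rw [mem_closedNeighborhood_starBox, starBoxDist_center]
  constructor
  · intro h
    interval_cases hn : (Finset.univ.filter fun i => a i ≠ c i).card
    · left
      rw [Finset.card_eq_zero, Finset.filter_eq_empty_iff] at hn
      funext i
      simpa using hn (Finset.mem_univ i)
    · right; left
      obtain ⟨i, hi⟩ := Finset.card_eq_one.1 hn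
      have hm : ∀ k, a k ≠ c k ↔ k = i := fun k => by simpa using Finset.ext_iff.1 hi k
      refine ⟨i, a i, (hm i).2 rfl, funext fun k => ?_⟩
      by_cases hk : k = i
      · subst hk; simp
      · rw [Function.update_of_ne hk]
        exact not_not.1 (mt (hm k).1 hk)
    · right; right
      obtain ⟨i, j, hij, hi⟩ := Finset.card_eq_two.1 hn
      have hm : ∀ k, a k ≠ c k ↔ k = i ∨ k = j := fun k => by simpa using Finset.ext_iff.1 hi k
      refine ⟨i, j, a i, a j, hij, (hm i).2 (Or.inl rfl), (hm j).2 (Or.inr rfl),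
        funext fun k => ?_⟩
      by_cases hk : k = j
      · subst hk; simp
      · by_cases hk' : k = i
        · subst hk'; simp [hk]
        · rw [Function.update_of_ne hk, Function.update_of_ne hk']
          exact not_not.1 (mt (hm k).1 (by tauto))
  · rintro (rfl | ⟨i, x, -, rfl⟩ | ⟨i, j, x, y, -, -, -, rfl⟩)
    · simp
    · refine (Finset.card_le_card (t := {i}) fun k hk => ?_).trans (by simp)
      rw [Finset.mem_filter] at hk
      grind
    · refine (Finset.card_le_card (t := {i, j}) fun k hk => ?_).trans Finset.card_le_two
      rw [Finset.mem_filter] at hk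
      grind

end StarDistance

/-! ### The embedding of the partial star product -/

section Embedding

variable {V : Type u} {G : SimpleGraph V} {v : V}

/-- Each non-central vertex of a star factor is adjacent to `v` by definition of the class
neighbourhood. -/
theorem starProduct_eq_starBox (G : SimpleGraph V) (v : V) :
    starProduct G v = starBox (starCenter G v) := by
  unfold starProduct starBox
  congr 1
  funext φ
  ext x y
  rw [SimpleGraph.starGraph_adj]
  constructor
  · rintro ⟨h, h'⟩
    exact ⟨fun e => h.ne (congrArg _ e), h'.imp Subtype.ext Subtype.ext⟩
  · rintro ⟨h, rfl | rfl⟩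
    · refine ⟨?_, Or.inl rfl⟩
      obtain ⟨y, rfl | ⟨hy, -⟩⟩ := y
      · exact absurd rfl h
      · exact hy
    · refine ⟨?_, Or.inr rfl⟩
      obtain ⟨x, rfl | ⟨hx, -⟩⟩ := x
      · exact absurd rfl h
      · exact hx.symm

/-! ### Squares spanned by edges of different local classes -/

theorem classOf_eq_iff {u w : V} {hu : G.Adj v u} {hw : G.Adj v w} :
    classOf G v u hu = classOf G v w hw ↔ localStar G v ⟨s(v, u), hu⟩ ⟨s(v, w), hw⟩ :=
  Subtype.ext_iff.trans Quotient.eq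

/-- `x` is the top of a chordless square spanned by the edges from `v` to `u` and `w`, which lie in
different classes. -/
def IsTop (G : SimpleGraph V) (v u w x : V) : Prop :=
  ∃ (hu : G.Adj v u) (hw : G.Adj v w), IsChordlessSquare G v u x w ∧
    classOf G v u hu ≠ classOf G v w hw

theorem IsTop.symm {u w x : V} (h : IsTop G v u w x) : IsTop G v w u x := by
  obtain ⟨hu, hw, ⟨⟨h1, h2, h3, h4, h5, h6⟩, h7, h8⟩, hc⟩ := h
  exact ⟨hw, hu, ⟨⟨hw, h3.symm, h2.symm, hu.symm, h5, h6.symm⟩, h7, fun h => h8 h.symm⟩, hc.symm⟩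

theorem spans_of_classOf_ne {u w : V} {hu : G.Adj v u} {hw : G.Adj v w}
    (h : classOf G v u hu ≠ classOf G v w hw) : SpansUniqueChordlessSquare G v u w := by
  by_contra hs
  refine h (classOf_eq_iff.2 (Relation.EqvGen.rel _ _ ⟨Or.inl (Sym2.mem_mk_left _ _), ?_⟩))
  exact Or.inl ⟨v, u, w, fun e => h (by subst e; rfl), rfl, rfl, hs⟩

theorem exists_isTop {u w : V} {hu : G.Adj v u} {hw : G.Adj v w}
    (h : classOf G v u hu ≠ classOf G v w hw) : ∃ x, IsTop G v u w x := by
  obtain ⟨x, hx, -⟩ := spans_of_classOf_ne h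
  exact ⟨x, hu, hw, hx, h⟩

theorem IsTop.eq_of_isSquare {u w x y : V} (h : IsTop G v u w x) (hy : IsSquare G v u y w) :
    y = x := by
  obtain ⟨hu, hw, hs, hc⟩ := h
  obtain ⟨z, hz, hz'⟩ := spans_of_classOf_ne hc
  exact (hz' y hy).trans (hz' x hs.1).symm

theorem IsTop.localStar_opposite {u w x : V} (h : IsTop G v u w x) (hux : G.Adj u x)
    (hw : G.Adj v w) : localStar G v ⟨s(u, x), hux⟩ ⟨s(v, w), hw⟩ := by
  obtain ⟨hu, -, ⟨⟨h1, h2, h3, h4, h5, h6⟩, h7, h8⟩, hc⟩ := h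
  refine Relation.EqvGen.rel _ _ ⟨Or.inr (Sym2.mem_mk_left _ _), Or.inr (Or.inl
    ⟨u, x, w, v, ⟨⟨h2, h3, h4, h1, h6, h5.symm⟩, h8, fun h => h7 h.symm⟩, rfl, Sym2.eq_swap⟩)⟩

/-- The top of a spanned square has only two neighbours in common with the centre. -/
theorem IsTop.eq_or_eq {u w x u' : V} (h : IsTop G v u w x) (hu' : G.Adj v u')
    (hx : G.Adj u' x) : u' = u ∨ u' = w := by
  by_contra! hne
  have hopp := h.symm.localStar_opposite
  obtain ⟨hu, hw, ⟨⟨h1, h2, h3, h4, h5, h6⟩, h7, h8⟩, hc⟩ := h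
  refine hc (classOf_eq_iff.2 ?_)
  refine (localStar G v).trans' ((localStar G v).symm' (hopp h3.symm hu)) ?_
  refine (localStar G v).symm'
    (Relation.EqvGen.rel _ _ ⟨Or.inl (Sym2.mem_mk_left _ _), Or.inl ?_⟩)
  -- The edges `wv` and `wx` lie in two squares, with opposite vertices `u` and `u'`, so they are in
  -- `δ`; `wx` is also opposite to `vu`.
  refine ⟨w, v, x, h5, Sym2.eq_swap, rfl, ?_⟩
  rintro ⟨z, -, hz⟩
  have a1 := hz u ⟨h4, hu, h2, h3, h6.symm, h5⟩
  have a2 := hz u' ⟨h4, hu', hx, h3, hne.2.symm, h5⟩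
  exact hne.1 (a2.trans a1.symm)

theorem IsTop.not_adj {u w x : V} (h : IsTop G v u w x) : ¬ G.Adj v x := h.2.2.1.2.1

theorem IsTop.ne {u w x : V} (h : IsTop G v u w x) : v ≠ x := h.2.2.1.1.2.2.2.2.1

theorem IsTop.adj {u w x : V} (h : IsTop G v u w x) : G.Adj u x := h.2.2.1.1.2.1

/-- The neighbours of `v` on which the vertex `x` of the partial star product depends. -/
def Below (G : SimpleGraph V) (v u x : V) : Prop :=
  G.Adj v u ∧ (x = u ∨ ∃ w, IsTop G v u w x)

theorem not_below_center (u : V) : ¬ Below G v u v := by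
  rintro ⟨h, rfl | ⟨w, hw⟩⟩
  · exact h.ne rfl
  · exact hw.ne rfl

theorem below_neighbor_iff {u x : V} (hx : G.Adj v x) : Below G v u x ↔ u = x := by
  constructor
  · rintro ⟨h, rfl | ⟨w, hw⟩⟩
    · rfl
    · exact absurd hx hw.not_adj
  · rintro rfl
    exact ⟨hx, Or.inl rfl⟩

theorem IsTop.below_iff {u w x u' : V} (h : IsTop G v u w x) :
    Below G v u' x ↔ u' = u ∨ u' = w := by
  constructor
  · rintro ⟨h', rfl | ⟨w', hw'⟩⟩
    · exact absurd h' h.not_adj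
    · exact h.eq_or_eq h' hw'.adj
  · rintro (rfl | rfl)
    · exact ⟨h.1, Or.inr ⟨_, h⟩⟩
    · exact ⟨h.2.1, Or.inr ⟨_, h.symm⟩⟩

/-- The two neighbours below a top lie in different classes; this makes the choice in `starCoord`
unambiguous. -/
theorem Below.eq_of_classOf_eq {u u' x : V} (h : Below G v u x) (h' : Below G v u' x)
    (hc : classOf G v u h.1 = classOf G v u' h'.1) : u = u' := by
  obtain ⟨hu, rfl | ⟨w, hw⟩⟩ := id h
  · exact ((below_neighbor_iff hu).1 h').symm
  · obtain rfl | rfl := hw.below_iff.1 h'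
    · rfl
    · exact absurd hc hw.2.2.2

/-! ### Coordinates of the vertices of the partial star product -/

open Classical in
/-- The coordinates of a vertex of the partial star product. -/
noncomputable def starCoord (G : SimpleGraph V) (v x : V) :
    ∀ φ : LocalClass G v, classNeighborhood G v φ := fun φ =>
  if h : ∃ (u : V) (hu : Below G v u x), classOf G v u hu.1 = φ then
    ⟨h.choose, Or.inr ⟨h.choose_spec.choose.1, h.choose_spec.choose_spec⟩⟩
  else starCenter G v φ

/-- The leaf of the star factor at a neighbour of the centre. -/
def leaf {u : V} (hu : G.Adj v u) : classNeighborhood G v (classOf G v u hu) :=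
  ⟨u, Or.inr ⟨hu, rfl⟩⟩

theorem leaf_ne {u : V} (hu : G.Adj v u) : leaf hu ≠ starCenter G v (classOf G v u hu) :=
  fun h => hu.ne (congrArg Subtype.val h).symm

theorem exists_leaf {φ : LocalClass G v} {x : classNeighborhood G v φ}
    (hx : x ≠ starCenter G v φ) :
    ∃ (u : V) (hu : G.Adj v u) (h : classOf G v u hu = φ), x = h ▸ leaf hu := by
  obtain ⟨x, rfl | ⟨h, rfl⟩⟩ := x
  · exact absurd rfl hx
  · exact ⟨x, h, rfl, rfl⟩

theorem starCoord_of_below {u x : V} (h : Below G v u x) :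
    starCoord G v x (classOf G v u h.1) = leaf h.1 := by
  have hex : ∃ (u' : V) (hu : Below G v u' x), classOf G v u' hu.1 = classOf G v u h.1 :=
    ⟨u, h, rfl⟩
  rw [starCoord, dif_pos hex]
  exact Subtype.ext (hex.choose_spec.choose.eq_of_classOf_eq h hex.choose_spec.choose_spec)

theorem starCoord_of_not_below {x : V} {φ : LocalClass G v}
    (h : ∀ u (hu : Below G v u x), classOf G v u hu.1 ≠ φ) :
    starCoord G v x φ = starCenter G v φ := by
  rw [starCoord, dif_neg]
  rintro ⟨u, hu, hc⟩
  exact h u hu hc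

/-- Coordinates remember the neighbours below a vertex, which is what injectivity rests on. -/
theorem below_of_starCoord {u x : V} (hu : G.Adj v u)
    (h : starCoord G v x (classOf G v u hu) = leaf hu) : Below G v u x := by
  by_cases hex : ∃ (u' : V) (hu' : Below G v u' x), classOf G v u' hu'.1 = classOf G v u hu
  · rw [starCoord, dif_pos hex] at h
    have h' : hex.choose = u := congrArg Subtype.val h
    exact h' ▸ hex.choose_spec.choose
  · rw [starCoord, dif_neg hex] at h
    exact absurd h.symm (leaf_ne hu)

theorem starCoord_center (G : SimpleGraph V) (v : V) : starCoord G v v = starCenter G v :=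
  funext fun _ => starCoord_of_not_below fun u hu => absurd hu (not_below_center u)

variable [DecidableEq (LocalClass G v)]

theorem starCoord_neighbor {u : V} (hu : G.Adj v u) :
    starCoord G v u = Function.update (starCenter G v) (classOf G v u hu) (leaf hu) := by
  funext φ
  by_cases hφ : φ = classOf G v u hu
  · subst hφ
    rw [Function.update_self]
    exact starCoord_of_below ((below_neighbor_iff hu).2 rfl)
  · rw [Function.update_of_ne hφ]
    refine starCoord_of_not_below fun u' hu' hc => hφ ?_
    obtain rfl := (below_neighbor_iff hu).1 hu'
    exact hc.symm

theorem IsTop.starCoord_eq {u w x : V} (h : IsTop G v u w x) :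
    starCoord G v x = Function.update (starCoord G v u) (classOf G v w h.2.1) (leaf h.2.1) := by
  have hx := fun u' => h.below_iff (u' := u')
  funext φ
  by_cases hφ : φ = classOf G v w h.2.1
  · subst hφ
    rw [Function.update_self]
    exact starCoord_of_below ((hx w).2 (Or.inr rfl))
  · rw [Function.update_of_ne hφ, starCoord_neighbor h.1]
    by_cases hφ' : φ = classOf G v u h.1
    · subst hφ'
      rw [Function.update_self]
      exact starCoord_of_below ((hx u).2 (Or.inl rfl))
    · rw [Function.update_of_ne hφ']
      refine starCoord_of_not_below fun u' hu' hc => ?_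
      obtain rfl | rfl := (hx u').1 hu'
      · exact hφ' hc.symm
      · exact hφ hc.symm

theorem IsTop.starCoord_apply {u w x : V} (h : IsTop G v u w x) :
    starCoord G v u (classOf G v w h.2.1) = starCenter G v _ := by
  rw [starCoord_neighbor h.1, Function.update_of_ne h.2.2.2.symm]

end Embedding

/-! ### The isomorphism onto the ball of radius two -/

section Isomorphism

variable {V : Type u} {G : SimpleGraph V} {v : V}

theorem psp_adj_iff {x y : V} : (partialStarProduct G v).Adj x y ↔
    (x = v ∧ G.Adj v y) ∨ (y = v ∧ G.Adj v x) ∨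
      (∃ w, IsTop G v x w y) ∨ ∃ w, IsTop G v y w x := by
  constructor
  · rintro (⟨h1, h2⟩ | ⟨u, z, w, hu, hw, hs, hc, he⟩)
    · rcases Sym2.mem_iff.1 h2 with rfl | rfl
      · exact Or.inl ⟨rfl, h1⟩
      · exact Or.inr (Or.inl ⟨rfl, G.adj_symm h1⟩)
    · have ht : IsTop G v u w z := ⟨hu, hw, hs, fun h => hc (classOf_eq_iff.1 h)⟩
      rcases Sym2.eq_iff.1 he with ⟨rfl, rfl⟩ | ⟨rfl, rfl⟩
      · exact Or.inr (Or.inr (Or.inl ⟨w, ht⟩))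
      · exact Or.inr (Or.inr (Or.inr ⟨w, ht⟩))
  · have htop {x y w : V} (h : IsTop G v x w y) : (partialStarProduct G v).Adj x y :=
      Or.inr ⟨x, y, w, h.1, h.2.1, h.2.2.1, fun hl => h.2.2.2 (classOf_eq_iff.2 hl), rfl⟩
    rintro (⟨rfl, h⟩ | ⟨rfl, h⟩ | ⟨w, h⟩ | ⟨w, h⟩)
    · exact Or.inl ⟨h, Sym2.mem_mk_left _ _⟩
    · exact Or.inl ⟨h.symm, Sym2.mem_mk_right _ _⟩
    · exact htop h
    · exact (htop h).symm

theorem mem_psp_verts_iff {x : V} : x ∈ (partialStarProduct G v).verts ↔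
    x = v ∨ G.Adj v x ∨ ∃ u w, IsTop G v u w x := by
  constructor
  · rintro (rfl | ⟨e, he, hx⟩)
    · exact Or.inl rfl
    · obtain ⟨y, rfl⟩ := Sym2.mem_iff_exists.1 hx
      rcases psp_adj_iff.1 he with ⟨rfl, -⟩ | ⟨-, h⟩ | ⟨w, h⟩ | ⟨w, h⟩
      · exact Or.inl rfl
      · exact Or.inr (Or.inl h)
      · exact Or.inr (Or.inl h.1)
      · exact Or.inr (Or.inr ⟨y, w, h⟩)
  · rintro (rfl | h | ⟨u, w, h⟩)
    · exact Or.inl rfl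
    · exact Or.inr ⟨s(v, x), psp_adj_iff.2 (Or.inl ⟨rfl, h⟩), Sym2.mem_mk_right _ _⟩
    · exact Or.inr ⟨s(u, x), psp_adj_iff.2 (Or.inr (Or.inr (Or.inl ⟨w, h⟩))),
        Sym2.mem_mk_right _ _⟩

theorem Below.of_starCoord_eq {u x y : V} (h : Below G v u x)
    (hxy : starCoord G v x = starCoord G v y) : Below G v u y :=
  below_of_starCoord h.1 (by rw [← hxy, starCoord_of_below h])

/-- The number of neighbours below (0, 1 or 2) tells the three kinds of vertices apart. -/
theorem eq_of_below_iff {x y : V} (hx : x ∈ (partialStarProduct G v).verts)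
    (hy : y ∈ (partialStarProduct G v).verts) (h : ∀ u, Below G v u x ↔ Below G v u y) :
    x = y := by
  rcases mem_psp_verts_iff.1 hx with rfl | hx | ⟨u, w, hx⟩ <;>
    rcases mem_psp_verts_iff.1 hy with rfl | hy | ⟨u', w', hy⟩
  · rfl
  · exact absurd ((h y).2 ((below_neighbor_iff hy).2 rfl)) (not_below_center _)
  · exact absurd ((h u').2 (hy.below_iff.2 (Or.inl rfl))) (not_below_center _)
  · exact absurd ((h x).1 ((below_neighbor_iff hx).2 rfl)) (not_below_center _)
  · exact (below_neighbor_iff hy).1 ((h x).1 ((below_neighbor_iff hx).2 rfl))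
  · have h1 := (below_neighbor_iff hx).1 ((h u').2 (hy.below_iff.2 (Or.inl rfl)))
    have h2 := (below_neighbor_iff hx).1 ((h w').2 (hy.below_iff.2 (Or.inr rfl)))
    exact absurd (h1.trans h2.symm) hy.2.2.1.1.2.2.2.2.2
  · exact absurd ((h u).1 (hx.below_iff.2 (Or.inl rfl))) (not_below_center _)
  · have h1 := (below_neighbor_iff hy).1 ((h u).1 (hx.below_iff.2 (Or.inl rfl)))
    have h2 := (below_neighbor_iff hy).1 ((h w).1 (hx.below_iff.2 (Or.inr rfl)))
    exact absurd (h1.trans h2.symm) hx.2.2.1.1.2.2.2.2.2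
  -- If both vertices are tops, `y` is also adjacent to `u` and `w`, and these span only one square
  -- at `v`.
  · have hadj : ∀ z, Below G v z y → G.Adj z y := fun z hz => by
      rcases hy.below_iff.1 hz with rfl | rfl
      · exact hy.adj
      · exact hy.symm.adj
    refine (hx.eq_of_isSquare ⟨hx.1, hadj u ((h u).1 (hx.below_iff.2 (Or.inl rfl))),
      (hadj w ((h w).1 (hx.below_iff.2 (Or.inr rfl)))).symm, hx.2.1.symm, hy.ne,
      hx.2.2.1.1.2.2.2.2.2⟩).symm

theorem starCoord_injOn : Set.InjOn (starCoord G v) (partialStarProduct G v).verts :=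
  fun _ hx _ hy h =>
    eq_of_below_iff hx hy fun _ =>
      ⟨fun hu => hu.of_starCoord_eq h, fun hu => hu.of_starCoord_eq h.symm⟩

/-- Every edge of the partial star product is carried to an edge of `H` whose colour is its local
class. -/
theorem exists_update_of_psp_adj [DecidableEq (LocalClass G v)] {x y : V}
    (h : (partialStarProduct G v).Adj x y) :
    ∃ (a b : V) (_ : s(x, y) = s(a, b)) (hab : G.Adj a b) (φ : LocalClass G v)
      (z : ∀ φ : LocalClass G v, classNeighborhood G v φ) (t : classNeighborhood G v φ),
      t ≠ starCenter G v φ ∧ Quotient.mk (localStar G v) ⟨s(a, b), hab⟩ = φ.1 ∧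
      starCoord G v a = Function.update z φ (starCenter G v φ) ∧
      starCoord G v b = Function.update z φ t := by
  have hcen {y : V} (h : G.Adj v y) : ∃ (hab : G.Adj v y) (φ : LocalClass G v)
      (z : ∀ φ : LocalClass G v, classNeighborhood G v φ) (t : classNeighborhood G v φ),
      t ≠ starCenter G v φ ∧ Quotient.mk (localStar G v) ⟨s(v, y), hab⟩ = φ.1 ∧
      starCoord G v v = Function.update z φ (starCenter G v φ) ∧
      starCoord G v y = Function.update z φ t :=
    ⟨h, classOf G v y h, starCenter G v, leaf h, leaf_ne h, rfl,
      by rw [starCoord_center, Function.update_eq_self], starCoord_neighbor h⟩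
  -- The edge `xy` is opposite to `vw`: it has the class of `vw`, and passing from `x` to `y`
  -- inserts the leaf `w`.
  have htop {x y w : V} (h : IsTop G v x w y) : ∃ (hab : G.Adj x y) (φ : LocalClass G v)
      (z : ∀ φ : LocalClass G v, classNeighborhood G v φ) (t : classNeighborhood G v φ),
      t ≠ starCenter G v φ ∧ Quotient.mk (localStar G v) ⟨s(x, y), hab⟩ = φ.1 ∧
      starCoord G v x = Function.update z φ (starCenter G v φ) ∧
      starCoord G v y = Function.update z φ t :=
    ⟨h.adj, classOf G v w h.2.1, starCoord G v x, leaf h.2.1, leaf_ne h.2.1,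
      Quotient.sound (h.localStar_opposite h.adj h.2.1),
      by rw [← h.starCoord_apply, Function.update_eq_self], h.starCoord_eq⟩
  rcases psp_adj_iff.1 h with ⟨rfl, h⟩ | ⟨rfl, h⟩ | ⟨w, h⟩ | ⟨w, h⟩
  · exact ⟨_, _, rfl, hcen h⟩
  · exact ⟨_, _, Sym2.eq_swap, hcen h⟩
  · exact ⟨_, _, rfl, htop h⟩
  · exact ⟨_, _, Sym2.eq_swap, htop h⟩

theorem starBox_adj_starCoord {x y : V} (h : (partialStarProduct G v).Adj x y) :
    (starBox (starCenter G v)).Adj (starCoord G v x) (starCoord G v y) := by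
  classical
  obtain ⟨a, b, he, hab, φ, z, t, ht, -, ha, hb⟩ := exists_update_of_psp_adj h
  have key : (starBox (starCenter G v)).Adj (starCoord G v a) (starCoord G v b) := by
    rw [ha, hb]
    exact starBox_adj_update _ z ht
  rcases Sym2.eq_iff.1 he with ⟨rfl, rfl⟩ | ⟨rfl, rfl⟩
  · exact key
  · exact key.symm

theorem exists_below_of_starCoord_ne {x : V} {φ : LocalClass G v}
    (h : starCoord G v x φ ≠ starCenter G v φ) :
    ∃ (u : V) (hu : Below G v u x), classOf G v u hu.1 = φ := by
  by_contra! hn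
  exact h (starCoord_of_not_below hn)

/-- Centring one coordinate of a neighbour gives `v`, and of a top gives the other neighbour below
it; by injectivity `x` is that vertex. -/
theorem psp_adj_of_starCoord {x y : V} {φ : LocalClass G v}
    (hx : x ∈ (partialStarProduct G v).verts)
    (hne : starCoord G v y φ ≠ starCenter G v φ) (hc : starCoord G v x φ = starCenter G v φ)
    (h : ∀ ψ, ψ ≠ φ → starCoord G v x ψ = starCoord G v y ψ) :
    (partialStarProduct G v).Adj x y := by
  classical
  obtain ⟨u, hu, rfl⟩ := exists_below_of_starCoord_ne hne
  obtain ⟨hvu, rfl | ⟨w, hw⟩⟩ := id hu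
  · have : x = v := by
      refine starCoord_injOn hx (Or.inl rfl) (funext fun ψ => ?_)
      rw [starCoord_center]
      by_cases hψ : ψ = classOf G v y hvu
      · subst hψ; exact hc
      · rw [h ψ hψ, starCoord_neighbor hvu, Function.update_of_ne hψ]
    exact psp_adj_iff.2 (Or.inl ⟨this, hvu⟩)
  · have : x = w := by
      refine starCoord_injOn hx (mem_psp_verts_iff.2 (Or.inr (Or.inl hw.2.1)))
        (funext fun ψ => ?_)
      by_cases hψ : ψ = classOf G v u hvu
      · subst hψ; rw [hc, hw.symm.starCoord_apply]
      · rw [h ψ hψ, hw.symm.starCoord_eq, Function.update_of_ne hψ]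
    subst this
    exact psp_adj_iff.2 (Or.inr (Or.inr (Or.inl ⟨u, hw.symm⟩)))

theorem psp_adj_iff_starCoord {x y : V} (hx : x ∈ (partialStarProduct G v).verts)
    (hy : y ∈ (partialStarProduct G v).verts) :
    (starBox (starCenter G v)).Adj (starCoord G v x) (starCoord G v y) ↔
      (partialStarProduct G v).Adj x y := by
  refine ⟨fun h => ?_, starBox_adj_starCoord⟩
  obtain ⟨φ, ⟨hne, hc | hc⟩, h⟩ := (starBox_adj _).1 h
  · exact psp_adj_of_starCoord hx (fun h => hne (hc.trans h.symm)) hc h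
  · exact (psp_adj_of_starCoord hy (fun h => hne (h.trans hc.symm)) hc
      fun ψ hψ => (h ψ hψ).symm).symm

theorem starCoord_mem_closedNeighborhood [Finite (LocalClass G v)] {x : V}
    (hx : x ∈ (partialStarProduct G v).verts) :
    starCoord G v x ∈ closedNeighborhood (starBox (starCenter G v)) 2 (starCenter G v) := by
  classical
  rw [mem_closedNeighborhood_two_iff]
  rcases mem_psp_verts_iff.1 hx with rfl | hx | ⟨u, w, hx⟩
  · exact Or.inl (starCoord_center G x)
  · exact Or.inr (Or.inl ⟨_, _, leaf_ne hx, starCoord_neighbor hx⟩)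
  · refine Or.inr (Or.inr ⟨_, _, _, _, hx.2.2.2, leaf_ne hx.1, leaf_ne hx.2.1, ?_⟩)
    rw [hx.starCoord_eq, starCoord_neighbor hx.1]

theorem exists_starCoord_eq [Finite (LocalClass G v)]
    {a : ∀ φ : LocalClass G v, classNeighborhood G v φ}
    (ha : a ∈ closedNeighborhood (starBox (starCenter G v)) 2 (starCenter G v)) :
    ∃ x ∈ (partialStarProduct G v).verts, starCoord G v x = a := by
  classical
  rcases (mem_closedNeighborhood_two_iff _).1 ha with
    rfl | ⟨φ, t, ht, rfl⟩ | ⟨φ, ψ, s, t, hne, hs, ht, rfl⟩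
  · exact ⟨v, Or.inl rfl, starCoord_center G v⟩
  · obtain ⟨u, hu, rfl, rfl⟩ := exists_leaf ht
    exact ⟨u, mem_psp_verts_iff.2 (Or.inr (Or.inl hu)), starCoord_neighbor hu⟩
  · obtain ⟨u, hu, rfl, rfl⟩ := exists_leaf hs
    obtain ⟨w, hw, rfl, rfl⟩ := exists_leaf ht
    obtain ⟨x, hx⟩ := exists_isTop hne
    exact ⟨x, mem_psp_verts_iff.2 (Or.inr (Or.inr ⟨u, w, hx⟩)),
      by rw [hx.starCoord_eq, starCoord_neighbor]⟩

/-- The partial star product is isomorphic to the subgraph of the product of its star factors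
induced by the vertices at distance at most two from the centre. -/
noncomputable def starIso [Finite (LocalClass G v)] : (partialStarProduct G v).coe ≃g
    (starBox (starCenter G v)).induce
      (closedNeighborhood (starBox (starCenter G v)) 2 (starCenter G v)) where
  toEquiv := Equiv.ofBijective
    (fun x => ⟨starCoord G v x.1, starCoord_mem_closedNeighborhood x.2⟩)
    ⟨fun x y h => Subtype.ext (starCoord_injOn x.2 y.2 (congrArg Subtype.val h)), fun a => by
      obtain ⟨x, hx, h⟩ := exists_starCoord_eq a.2
      exact ⟨⟨x, hx⟩, Subtype.ext h⟩⟩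
  map_rel_iff' {x y} := psp_adj_iff_starCoord x.2 y.2

theorem intoHom_starIso [Finite (LocalClass G v)] (x : (partialStarProduct G v).verts) :
    intoHom starIso x = starCoord G v x.1 := rfl

/-- The colour of the image of an edge of the partial star product is its local class. -/
theorem exists_fibreEdge_eq [Finite (LocalClass G v)] [DecidableEq (LocalClass G v)]
    (e : (partialStarProduct G v).coe.edgeSet) :
    ∃ (φ : LocalClass G v) (z : ∀ φ : LocalClass G v, classNeighborhood G v φ)
      (t : classNeighborhood G v φ) (ht : t ≠ starCenter G v φ),
      Quotient.mk (localStar G v) ((partialStarProduct G v).hom.mapEdgeSet e) = φ.1 ∧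
      (intoHom starIso).mapEdgeSet e = fibreEdge (starCenter G v) z ht := by
  obtain ⟨e, he⟩ := e
  induction e with | _ x y
  have he' : (partialStarProduct G v).Adj x.1 y.1 := he
  obtain ⟨a, b, hs, hab, φ, z, t, ht, hφ, ha, hb⟩ := exists_update_of_psp_adj he'
  refine ⟨φ, z, t, ht, ?_, Subtype.ext ?_⟩
  · rw [← hφ]
    exact congrArg _ (Subtype.ext hs)
  · change s(starCoord G v x.1, starCoord G v y.1) =
      s(Function.update z φ (starCenter G v φ), Function.update z φ t)
    rw [← ha, ← hb]
    exact congrArg (Sym2.map (starCoord G v)) hs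

theorem deltaStar_of_restrictedRel [Finite (LocalClass G v)]
    {e f : (partialStarProduct G v).coe.edgeSet} (h : restrictedRel G v e f) :
    deltaStar (starBox (starCenter G v)) ((intoHom starIso).mapEdgeSet e)
      ((intoHom starIso).mapEdgeSet f) := by
  classical
  obtain ⟨φ, z, t, ht, hφ, he⟩ := exists_fibreEdge_eq e
  obtain ⟨ψ, z', t', ht', hψ, hf⟩ := exists_fibreEdge_eq f
  have hq : Quotient.mk (localStar G v) ((partialStarProduct G v).hom.mapEdgeSet e) =
      Quotient.mk (localStar G v) ((partialStarProduct G v).hom.mapEdgeSet f) := Quotient.sound h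
  obtain rfl : φ = ψ := Subtype.ext (hφ.symm.trans (hq.trans hψ))
  rw [he, hf]
  exact deltaStar_fibreEdge _ z z' ht ht'

/-- The classes of the restricted relation correspond to the local classes. -/
theorem card_quotient_restrictedRel [Finite (LocalClass G v)] :
    Nat.card (Quotient (restrictedRel G v)) = Nat.card (LocalClass G v) := by
  classical
  -- Classes of a pulled-back relation are the classes of `𝔡_v*` met by edges of the partial star
  -- product; it remains to see that these are exactly the ones with an edge at `v`.
  refine Nat.card_congr ((Setoid.comapQuotientEquiv _ _).trans (Equiv.subtypeEquivRight ?_))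
  intro φ
  constructor
  · rintro ⟨e, rfl⟩
    obtain ⟨ψ, -, -, -, hψ, -⟩ := exists_fibreEdge_eq e
    obtain ⟨f, hf, hf'⟩ := ψ.2
    exact ⟨f, hf, hf'.trans hψ.symm⟩
  · rintro ⟨⟨e, he⟩, hv, rfl⟩
    obtain ⟨w, rfl⟩ := Sym2.mem_iff_exists.1 hv
    have hw : G.Adj v w := he
    exact ⟨⟨s(pspCenter G v, pspPrimal G v w hw), psp_adj_iff.2 (Or.inl ⟨rfl, hw⟩)⟩, rfl⟩

end Isomorphism

/-- A local class contains an edge at `v`, so its star has a leaf; primality of the star needs this.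
-/
theorem nontrivial_classNeighborhood {V : Type u} {G : SimpleGraph V} {v : V}
    (φ : LocalClass G v) : Nontrivial (classNeighborhood G v φ) := by
  obtain ⟨q, ⟨e, he⟩, hv, rfl⟩ := φ
  obtain ⟨w, rfl⟩ := Sym2.mem_iff_exists.1 hv
  exact ⟨leaf he, starCenter G v _, leaf_ne he⟩

end PSP

open PSP in
theorem mainTheorem1 {V : Type*} [Finite V] (G : SimpleGraph V) (hG : G.Connected) (v : V) :
    (∃ γ : (partialStarProduct G v).coe ≃g
          (starProduct G v).induce (closedNeighborhood (starProduct G v) 2 (starCenter G v)),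
        -- the isomorphism is the natural one on the centre and its neighbours
        intoHom γ (pspCenter G v) = starCenter G v ∧
        (∀ (w : V) (h : G.Adj v w) (φ : LocalClass G v),
          (φ = classOf G v w h → (intoHom γ (pspPrimal G v w h) φ : V) = w) ∧
          (φ ≠ classOf G v w h → (intoHom γ (pspPrimal G v w h) φ : V) = v)) ∧
        -- it is an isometric embedding into the product
        (∀ x y, (partialStarProduct G v).coe.edist x y =
          (starProduct G v).edist (intoHom γ x) (intoHom γ y)) ∧
        -- it carries the restricted relation into `δ(H)*`
        (∀ e f, restrictedRel G v e f →
          deltaStar (starProduct G v) ((intoHom γ).mapEdgeSet e) ((intoHom γ).mapEdgeSet f))) ∧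
    (∀ e f, deltaStar (starProduct G v) e f → sigma (starProduct G v) e f) ∧
    Nat.card (Quotient (sigma (starProduct G v))) = Nat.card (Quotient (restrictedRel G v)) := by
  classical
  have : Finite (Quotient (localStar G v)) := inferInstance
  have : Finite (LocalClass G v) := Subtype.finite
  have := nontrivial_classNeighborhood (G := G) (v := v)
  rw [starProduct_eq_starBox]
  refine ⟨⟨starIso, ?_, ?_, ?_, fun e f => deltaStar_of_restrictedRel⟩,
    fun e f => sigma_of_deltaStar, ?_⟩
  · exact starCoord_center G v
  · intro w h φ
    rw [intoHom_starIso]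
    refine ⟨?_, fun hφ => ?_⟩
    · rintro rfl
      exact congrArg Subtype.val (starCoord_of_below ((below_neighbor_iff h).2 rfl))
    · change (starCoord G v w φ).1 = v
      rw [starCoord_neighbor h, Function.update_of_ne hφ]
      rfl
  · intro x y
    rw [edist_iso starIso x y, edist_induce_closedNeighborhood]
    rfl
  · rw [card_quotient_sigma_starBox, card_quotient_restrictedRel]
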